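/- Let $k$ be a field (finite or infinite), let $V$ be a finite-dimensional vector space over $k$, and let $r \ge 0$ be an integer. The group $GL(V)$ acts diagonally on $V^{\otimes r}$ by $g(x_1\otimes\cdots\otimes x_r) = gx_1\otimes\cdots\otimes gx_r$, its subgroup $SL(V)$ acts by restriction, and the symmetric group $\mathfrak{S}_r$ acts by place permutation, $\sigma(x_1\otimes\cdots\otimes x_r) = x_{\sigma^{-1}(1)}\otimes\cdots\otimes x_{\sigma^{-1}(r)}$. Let $\mathrm{End}_{\mathfrak{S}_r}(V^{\otimes r})$ be the algebra of $k$-linear endomorphisms of $V^{\otimes r}$ that commute with the action of $\mathfrak{S}_r$. The linear extensions of the actions of $GL(V)$ and $SL(V)$ to their group algebras are algebra homomorphisms $$\varphi\colon k\,GL(V) \to \mathrm{End}_{\mathfrak{S}_r}(V^{\otimes r}), \qquad \varphi'\colon k\,SL(V) \to \mathrm{End}_{\mathfrak{S}_r}(V^{\otimes r}).$$ If $|k| > r$, then both $\varphi$ and $\varphi'$ are surjective. -/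

import Mathlib

open scoped TensorProduct

noncomputable section

namespace SchurWeyl

/-- Place permutation: `σ (x₁ ⊗ ⋯ ⊗ x_r) = x_{σ⁻¹ 1} ⊗ ⋯ ⊗ x_{σ⁻¹ r}`. -/
def placePerm (k V : Type*) [Field k] [AddCommGroup V] [Module k V] (r : ℕ) :
    Representation k (Equiv.Perm (Fin r)) (⨂[k]^r V) where
  toFun σ := (PiTensorProduct.reindex k (fun _ : Fin r => V) σ).toLinearMap
  map_one' := by
    ext x
    simp
    rfl
  map_mul' σ τ := by
    ext x
    simp [Equiv.Perm.mul_def]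
    rfl

theorem placePerm_tprod (k V : Type*) [Field k] [AddCommGroup V] [Module k V] (r : ℕ)
    (σ : Equiv.Perm (Fin r)) (x : Fin r → V) :
    placePerm k V r σ (PiTensorProduct.tprod k x) =
      PiTensorProduct.tprod k (fun i => x (σ⁻¹ i)) := by
  simp [placePerm]

/-- The diagonal action of `GL(V)` on tensors: `g (x₁ ⊗ ⋯ ⊗ x_r) = g x₁ ⊗ ⋯ ⊗ g x_r`. -/
def repGL (k V : Type*) [Field k] [AddCommGroup V] [Module k V] (r : ℕ) :
    Representation k (LinearMap.GeneralLinearGroup k V) (⨂[k]^r V) where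
  toFun g := PiTensorProduct.map (fun _ : Fin r => (g : V →ₗ[k] V))
  map_one' := by
    ext x
    simp
  map_mul' g h := by
    ext x
    simp

theorem repGL_tprod (k V : Type*) [Field k] [AddCommGroup V] [Module k V] (r : ℕ)
    (g : LinearMap.GeneralLinearGroup k V) (x : Fin r → V) :
    repGL k V r g (PiTensorProduct.tprod k x) =
      PiTensorProduct.tprod k (fun i => (g : V →ₗ[k] V) (x i)) := by
  simp [repGL]

/-- The action of `SL(V)` on tensors, by restriction from `GL(V)`. -/
def repSL (k V : Type*) [Field k] [AddCommGroup V] [Module k V] (r : ℕ) :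
    Representation k (SpecialLinearGroup k V) (⨂[k]^r V) :=
  (repGL k V r).comp (SpecialLinearGroup.toGeneralLinearGroup)

/-- `End_{𝔖_r}(V^{⊗ r})`: the algebra of linear endomorphisms commuting with all
place permutations. -/
def endSym (k V : Type*) [Field k] [AddCommGroup V] [Module k V] (r : ℕ) :
    Subalgebra k (Module.End k (⨂[k]^r V)) :=
  Subalgebra.centralizer k (Set.range (placePerm k V r))

theorem repGL_mem_endSym (k V : Type*) [Field k] [AddCommGroup V] [Module k V] (r : ℕ)
    (g : LinearMap.GeneralLinearGroup k V) : repGL k V r g ∈ endSym k V r := by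
  rw [endSym, Subalgebra.mem_centralizer_iff]
  rintro _ ⟨σ, rfl⟩
  ext x
  simp [repGL_tprod, placePerm_tprod]

theorem asAlgebraHom_mem {k G W : Type*} [Field k] [Group G] [AddCommGroup W] [Module k W]
    (ρ : Representation k G W) (S : Subalgebra k (Module.End k W)) (h : ∀ g, ρ g ∈ S)
    (a : MonoidAlgebra k G) : ρ.asAlgebraHom a ∈ S := by
  induction a using MonoidAlgebra.induction_on with
  | of g => simpa using h g
  | add a b ha hb => simpa using S.add_mem ha hb
  | smul c a ha => simpa using S.smul_mem ha c

/-- `φ : k GL(V) → End_{𝔖_r}(V^{⊗ r})`, the linear extension of the action of `GL(V)`. -/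
def phiGL (k V : Type*) [Field k] [AddCommGroup V] [Module k V] (r : ℕ) :
    MonoidAlgebra k (LinearMap.GeneralLinearGroup k V) →ₐ[k] endSym k V r :=
  (repGL k V r).asAlgebraHom.codRestrict (endSym k V r)
    (asAlgebraHom_mem _ _ (repGL_mem_endSym k V r))

/-- `φ' : k SL(V) → End_{𝔖_r}(V^{⊗ r})`, the linear extension of the action of `SL(V)`. -/
def phiSL (k V : Type*) [Field k] [AddCommGroup V] [Module k V] (r : ℕ) :
    MonoidAlgebra k (SpecialLinearGroup k V) →ₐ[k] endSym k V r :=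
  (repSL k V r).asAlgebraHom.codRestrict (endSym k V r)
    (asAlgebraHom_mem _ _ (fun g => repGL_mem_endSym k V r (g.toGeneralLinearGroup)))

end SchurWeyl

end

/-!
Schur-Weyl duality for `SL(V)` and `GL(V)` over a field `k` with more than `r` elements.

Since `φ'` factors through `φ`, it suffices to treat `SL(V)`. Suppose that `T` commutes with the
place permutations but is not in the span of the operators `g ⊗ ⋯ ⊗ g` with `g ∈ SL(V)`. Then some
linear functional `l` on `End(V^{⊗ r})` kills this span but not `T`. In a basis of `V`, the value
`l (g ⊗ ⋯ ⊗ g)` is a homogeneous polynomial `f` of degree `r` in the matrix entries of `g`, and `f`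
vanishes on `SL_n(k)`.

The heart of the proof is that such an `f` is zero (`eq_zero_of_eval_specialLinearGroup_eq_zero`).
Substituting a one-parameter family `A * (1 + s * E_ij) * B` into `f` gives a polynomial in `s` of
degree at most `r`; if it vanishes for `s ∈ k` it vanishes identically, because `|k| > r`.
Special linear groups of fields are generated by transvections, so the vanishing of `f` spreads from
`SL_n(k)` to `SL_n(K)`, one transvection at a time, for every extension field `K`
(`aeval_eq_zero_on_specialLinearGroup`). For `K` algebraically closed, every invertible matrix is a
scalar multiple of one of determinant `1`, so by homogeneity `f * det` vanishes everywhere, and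
`f = 0` since `K` is infinite.

Finally, the coefficient of `f` at a monomial is the sum of the values of `l` on the matrix units
of `V^{⊗ r}` in one orbit of the symmetric group, and the matrix entries of `T` are constant on such
orbits; hence `l T = 0` (`sum_mul_eq_zero_of_forall_specialLinearGroup`), a contradiction.
-/

namespace SchurWeyl

open Matrix MvPolynomial

/-! ### Generation of the special linear group by transvections -/

section Transvections

variable {ι K : Type*} [Fintype ι] [DecidableEq ι] [Field K]

/-- Whitehead's factorization of `diag(a, a⁻¹)`, placed in the coordinates `i` and `j`. -/
theorem diag2n_eq_prod_transvection {i j : ι} (hij : i ≠ j) (a : K) (ha : a ≠ 0) :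
    Matrix.SpecialLinearGroup.diag2n hij a ha =
      Matrix.SpecialLinearGroup.transvection hij a *
      Matrix.SpecialLinearGroup.transvection hij.symm (-a⁻¹) *
      Matrix.SpecialLinearGroup.transvection hij a *
      Matrix.SpecialLinearGroup.transvection hij (-1) *
      Matrix.SpecialLinearGroup.transvection hij.symm 1 *
      Matrix.SpecialLinearGroup.transvection hij (-1) := by
  have hD : (Matrix.SpecialLinearGroup.diag2n hij a ha).1 =
      1 + single i i (a - 1) + single j j (a⁻¹ - 1) := by
    ext p q
    simp only [Matrix.SpecialLinearGroup.diag2n_coe, diagonal_apply, Matrix.add_apply, one_apply,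
      single_apply]
    grind
  apply Matrix.SpecialLinearGroup.coeMonoidHom_injective
  simp only [map_mul, Matrix.SpecialLinearGroup.coeMonoidHom_apply,
    Matrix.SpecialLinearGroup.transvection_coe]
  rw [hD]
  simp only [mul_add, add_mul, mul_one, one_mul, single_mul_single_same,
    single_mul_single_of_ne _ _ _ _ hij, single_mul_single_of_ne _ _ _ _ hij.symm,
    add_zero]
  ext p q
  simp only [Matrix.add_apply, one_apply, single_apply]
  by_cases h1 : i = p <;> by_cases h2 : j = p <;> by_cases h3 : i = q <;> by_cases h4 : j = q <;>
    simp [h1, h2, h3, h4] <;> grind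

theorem closure_transvection_eq_top :
    Submonoid.closure (Set.range
      (TransvectionStruct.toSpecialLinearGroup : TransvectionStruct ι K → _)) = ⊤ := by
  refine eq_top_iff.2 fun g _ => ?_
  -- In size at most one the group is trivial and there are no transvections at all.
  rcases subsingleton_or_nontrivial ι with hι | hι
  · rw [Subsingleton.elim g 1]
    exact one_mem _
  set S := Submonoid.closure (Set.range
      (TransvectionStruct.toSpecialLinearGroup : TransvectionStruct ι K → _))
  have ht : ∀ (i j : ι) (hij : i ≠ j) (c : K), Matrix.SpecialLinearGroup.transvection hij c ∈ S :=
    fun i j hij c => Submonoid.subset_closure ⟨⟨i, j, hij, c⟩, rfl⟩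
  refine Matrix.SpecialLinearGroup.diagonal_transvection_induction' (· ∈ S) g
    (fun i j hij c hc => ?_) ht fun A B => S.mul_mem
  rw [diag2n_eq_prod_transvection]
  exact S.mul_mem (S.mul_mem (S.mul_mem (S.mul_mem (S.mul_mem (ht _ _ _ _) (ht _ _ _ _))
    (ht _ _ _ _)) (ht _ _ _ _)) (ht _ _ _ _)) (ht _ _ _ _)

end Transvections

/-! ### Homogeneous polynomials vanishing on the special linear group -/

section Vanishing

theorem eq_zero_of_natDegree_le_of_eval_algebraMap_eq_zero {k K : Type*} [Field k] [Field K]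
    [Algebra k K] {r : ℕ} (hr : (r : ℕ∞) < ENat.card k) {p : Polynomial K}
    (hp : p.natDegree ≤ r) (h : ∀ s : k, p.eval (algebraMap k K s) = 0) : p = 0 := by
  obtain ⟨t, -, ht⟩ := Set.exists_subset_encard_eq (s := (Set.univ : Set k)) (k := (r + 1 : ℕ))
    (by rw [Set.encard_univ]; exact_mod_cast Order.add_one_le_of_lt hr)
  have htf : t.Finite := Set.finite_of_encard_eq_coe ht
  have := htf.fintype
  refine p.eq_zero_of_natDegree_lt_card_of_eval_eq_zero (f := fun s : t => algebraMap k K s)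
    ((algebraMap k K).injective.comp Subtype.val_injective) (fun s => h s) ?_
  rw [Set.encard_eq_coe_toFinset_card, Nat.cast_inj, Set.toFinset_card] at ht
  omega

theorem eval_smul_of_isHomogeneous {σ R : Type*} [CommSemiring R] {f : MvPolynomial σ R} {r : ℕ}
    (hf : f.IsHomogeneous r) (c : R) (x : σ → R) : eval (c • x) f = c ^ r * eval x f := by
  rw [eval_eq, eval_eq, Finset.mul_sum]
  refine Finset.sum_congr rfl fun d hd => ?_
  have hdr : ∑ i ∈ d.support, d i = r := by
    have := hf (mem_support_iff.1 hd)
    simpa [Finsupp.weight_apply, Finsupp.sum] using this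
  simp only [Pi.smul_apply, smul_eq_mul, mul_pow, Finset.prod_mul_distrib,
    Finset.prod_pow_eq_pow_sum, hdr]
  ring

variable {ι k K : Type*} [Fintype ι] [DecidableEq ι] [Field k] [Field K] [Algebra k K]

/-- A form of degree `r < |k|` that vanishes on `SL_n(k)` vanishes on `SL_n(K)` for every extension
field `K` of `k`. -/
theorem aeval_eq_zero_on_specialLinearGroup {r : ℕ} (hr : (r : ℕ∞) < ENat.card k)
    {f : MvPolynomial (ι × ι) k} (hf : f.IsHomogeneous r)
    (h : ∀ g : Matrix.SpecialLinearGroup ι k, eval (fun p => g p.1 p.2) f = 0)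
    (g : Matrix.SpecialLinearGroup ι K) : aeval (fun p => g p.1 p.2) f = 0 := by
  -- Induction on the number of transvections in `g`. The factor `A` over `k` absorbs a first
  -- transvection whenever its parameter lies in `k`.
  suffices H : ∀ A : Matrix.SpecialLinearGroup ι k,
      aeval (fun p => (A.map (algebraMap k K) * g) p.1 p.2) f = 0 by
    simpa using H 1
  have hg : g ∈ Submonoid.closure (Set.range
      (TransvectionStruct.toSpecialLinearGroup : TransvectionStruct ι K → _)) := by
    rw [closure_transvection_eq_top]; trivial
  induction hg using Submonoid.closure_induction_left with
  | one =>
    intro A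
    have := congrArg (algebraMap k K) (h A)
    rw [map_zero] at this
    rw [← this, mul_one, aeval_def, eval₂_comp]
    rfl
  | mul_left x hx B _ ih =>
    obtain ⟨⟨i, j, hij, c⟩, rfl⟩ := hx
    rw [TransvectionStruct.toSpecialLinearGroup_mk]
    intro A
    -- Replacing the parameter of the first transvection by `s` gives the matrix `M + s • N`.
    set M : Matrix ι ι K := (A.map (algebraMap k K) * B).1
    set N : Matrix ι ι K := (A.map (algebraMap k K)).1 * single i j 1 * B.1
    have hMN : ∀ s : K, (A.map (algebraMap k K) *
        (Matrix.SpecialLinearGroup.transvection hij s * B)).1 = M + s • N := by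
      intro s
      simp only [M, N, Matrix.SpecialLinearGroup.coe_mul,
        Matrix.SpecialLinearGroup.transvection_coe]
      have hs : single i j s = s • single i j (1 : K) := by simp
      rw [hs, add_mul, one_mul, mul_add, smul_mul_assoc, mul_smul_comm, mul_assoc]
    set p : Polynomial K := aeval
      (fun q : ι × ι => Polynomial.C (M q.1 q.2) + Polynomial.C (N q.1 q.2) * Polynomial.X)
      (map (algebraMap k K) f) with hp
    have hpe : ∀ s : K, p.eval s =
        aeval (fun q => (A.map (algebraMap k K) *
          (Matrix.SpecialLinearGroup.transvection hij s * B)) q.1 q.2) f := by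
      intro s
      rw [hMN, hp, ← Polynomial.coe_evalRingHom, map_aeval, coe_eval₂Hom, eval₂_map, aeval_def]
      congr 1
      · ext x
        simp
      · ext q
        simp only [Polynomial.coe_evalRingHom, Polynomial.eval_add, Polynomial.eval_mul,
          Polynomial.eval_C, Polynomial.eval_X, Matrix.add_apply, Matrix.smul_apply, smul_eq_mul,
          mul_comm]
    have hp0 : p = 0 := by
      refine eq_zero_of_natDegree_le_of_eval_algebraMap_eq_zero hr ?_ fun s => ?_
      · have := aeval_natDegree_le (map (algebraMap k K) f)
          (hf.map _).totalDegree_le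
          (fun q : ι × ι => Polynomial.C (M q.1 q.2) + Polynomial.C (N q.1 q.2) * Polynomial.X)
          (n := 1) (fun q => by rw [add_comm]; exact Polynomial.natDegree_linear_le)
        simpa using this
      · rw [hpe]
        have := ih (A * Matrix.SpecialLinearGroup.transvection hij s)
        rw [← this]
        congr 3
        ext q
        have : (Matrix.SpecialLinearGroup.transvection hij s).map (algebraMap k K) =
            Matrix.SpecialLinearGroup.transvection hij (algebraMap k K s) := by
          ext a b
          simp only [Matrix.SpecialLinearGroup.map_apply_coe, RingHom.mapMatrix_apply, map_apply,
            Matrix.SpecialLinearGroup.transvection_coe, Matrix.add_apply, one_apply, single_apply,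
            map_add]
          split_ifs <;> simp
        rw [map_mul, this, mul_assoc]
    rw [← hpe, hp0, Polynomial.eval_zero]

/-- A form of degree `r < |k|` in the entries of a square matrix is determined by its values on
`SL_n(k)`. -/
theorem eq_zero_of_eval_specialLinearGroup_eq_zero {r : ℕ} (hr : (r : ℕ∞) < ENat.card k)
    {f : MvPolynomial (ι × ι) k} (hf : f.IsHomogeneous r)
    (h : ∀ g : Matrix.SpecialLinearGroup ι k, eval (fun p => g p.1 p.2) f = 0) : f = 0 := by
  let K := AlgebraicClosure k
  have hSL : ∀ g : Matrix.SpecialLinearGroup ι K,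
      eval (fun p => g p.1 p.2) (map (algebraMap k K) f) = 0 := by
    intro g
    rw [eval_map, ← aeval_def]
    exact aeval_eq_zero_on_specialLinearGroup hr hf h g
  have hmul : map (algebraMap k K) f * det (mvPolynomialX ι ι K) = 0 := by
    refine MvPolynomial.funext fun x => ?_
    rw [map_mul, map_zero, RingHom.map_det, RingHom.mapMatrix_apply]
    set X : Matrix ι ι K := (mvPolynomialX ι ι K).map (eval x)
    have hX : x = fun p => X p.1 p.2 := by ext p; simp [X]
    by_cases hd : X.det = 0
    · rw [hd, mul_zero]
    -- Write `X = c • Y` with `det Y = 1`; when `ι` is empty there is no root to extract.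
    obtain ⟨c, hc0, hc⟩ : ∃ c : K, c ≠ 0 ∧ c ^ Fintype.card ι = X.det := by
      rcases isEmpty_or_nonempty ι with hι | hι
      · exact ⟨1, one_ne_zero, by simp⟩
      · obtain ⟨c, hc⟩ := IsAlgClosed.exists_pow_nat_eq X.det (Fintype.card_pos (α := ι))
        exact ⟨c, by rintro rfl; simp at hc; exact hd hc.symm, hc⟩
    have hdet : (c⁻¹ • X).det = 1 := by
      rw [det_smul, inv_pow, hc, inv_mul_cancel₀ hd]
    have h0 := hSL ⟨c⁻¹ • X, hdet⟩
    have h1 : x = c • fun p : ι × ι => (c⁻¹ • X) p.1 p.2 := by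
      rw [hX]
      ext p
      simp [hc0]
    rw [h1, eval_smul_of_isHomogeneous (hf.map _)]
    exact mul_eq_zero_of_left (mul_eq_zero_of_right _ h0) _
  refine map_injective _ (algebraMap k K).injective ?_
  rw [map_zero]
  exact (mul_eq_zero.1 hmul).resolve_right (det_mvPolynomialX_ne_zero ι K)

end Vanishing

/-! ### Symmetric coefficient families -/

section Orbits

/-- The content of a word `w`: the multiset of its letters, encoded as the function counting how
often each letter occurs, so that it is the exponent of the monomial `∏ a, X (w a)`. -/
noncomputable def wordContent {ι : Type*} {r : ℕ} (w : Fin r → ι) : ι →₀ ℕ :=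
  ∑ a, Finsupp.single (w a) 1

theorem exists_perm_of_wordContent_eq {ι : Type*} {r : ℕ} {v w : Fin r → ι}
    (h : wordContent v = wordContent w) : ∃ σ : Equiv.Perm (Fin r), v = w ∘ σ := by
  classical
  have key : ∀ (u : Fin r → ι) (x : ι), wordContent u x = Fintype.card {a // u a = x} := by
    intro u x
    simp [wordContent, Finsupp.finsetSum_apply, Finsupp.single_apply, Fintype.card_subtype]
  have hcard : ∀ x, Fintype.card {a // v a = x} = Fintype.card {a // w a = x} := fun x => by
    rw [← key, ← key, h]
  exact ⟨Equiv.ofFiberEquiv fun x => Fintype.equivOfCardEq (hcard x),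
    funext fun a => (Equiv.ofFiberEquiv_map _ a).symm⟩

variable {ι k : Type*} [Fintype ι] [DecidableEq ι] [Field k]

/-- A linear functional (with coefficients `c`) on families indexed by words in matrix positions
vanishes on all symmetric families `t` as soon as it vanishes on the families
`w ↦ ∏ a, g (w a).1 (w a).2` of the `r`-th tensor powers of matrices `g` of determinant `1`. -/
theorem sum_mul_eq_zero_of_forall_specialLinearGroup {r : ℕ} (hr : (r : ℕ∞) < ENat.card k)
    (c t : (Fin r → ι × ι) → k)
    (hc : ∀ g : Matrix.SpecialLinearGroup ι k, ∑ w, c w * ∏ a, g (w a).1 (w a).2 = 0)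
    (ht : ∀ (w : Fin r → ι × ι) (σ : Equiv.Perm (Fin r)), t (w ∘ σ) = t w) :
    ∑ w, c w * t w = 0 := by
  set f : MvPolynomial (ι × ι) k := ∑ w, C (c w) * ∏ a, X (w a) with hf
  have hf0 : f = 0 := by
    refine eq_zero_of_eval_specialLinearGroup_eq_zero hr ?_ fun g => ?_
    · refine IsHomogeneous.sum _ _ _ fun w _ => ?_
      have h := (isHomogeneous_C (ι × ι) (c w)).mul
        (IsHomogeneous.prod Finset.univ (fun a => (X (w a) : MvPolynomial (ι × ι) k)) (fun _ => 1)
          fun a _ => isHomogeneous_X k (w a))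
      simpa using h
    · simpa [hf, map_sum, map_mul, map_prod] using hc g
  -- The coefficients of `f = 0` are the sums of `c` over the orbits of the symmetric group.
  have hcoeff : ∀ m : ι × ι →₀ ℕ, ∑ w with wordContent w = m, c w = 0 := by
    intro m
    have hm : coeff m f = 0 := by rw [hf0, coeff_zero]
    rw [← hm, hf, coeff_sum, Finset.sum_filter]
    refine Finset.sum_congr rfl fun w _ => ?_
    have hX : ∏ a, (X (w a) : MvPolynomial (ι × ι) k) = monomial (wordContent w) 1 :=
      (monomial_sum_one Finset.univ fun a => Finsupp.single (w a) 1).symm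
    rw [hX, coeff_C_mul, coeff_monomial, mul_ite, mul_one, mul_zero]
  rw [← Finset.sum_fiberwise_of_maps_to
    (fun w _ => Finset.mem_image_of_mem wordContent (Finset.mem_univ w))]
  refine Finset.sum_eq_zero fun m hm => ?_
  obtain ⟨w₀, -, rfl⟩ := Finset.mem_image.1 hm
  have : ∀ w ∈ Finset.univ.filter (fun w => wordContent w = wordContent w₀),
      c w * t w = c w * t w₀ := by
    intro w hw
    obtain ⟨σ, rfl⟩ := exists_perm_of_wordContent_eq (Finset.mem_filter.1 hw).2
    rw [ht]
  rw [Finset.sum_congr rfl this, ← Finset.sum_mul, hcoeff, zero_mul]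

end Orbits

/-! ### Endomorphisms of the tensor power -/

section TensorPower

theorem repr_placePerm {ι k V : Type*} [Field k] [AddCommGroup V] [Module k V] {r : ℕ}
    (b : Module.Basis ι k V) (σ : Equiv.Perm (Fin r))
    (x : ⨂[k]^r V) (I : Fin r → ι) :
    (Basis.piTensorProduct fun _ : Fin r => b).repr (placePerm k V r σ x) I =
      (Basis.piTensorProduct fun _ : Fin r => b).repr x (I ∘ σ) := by
  induction x using PiTensorProduct.induction_on with
  | smul_tprod c x =>
    simp only [map_smul, Finsupp.smul_apply, placePerm_tprod,
      Basis.piTensorProduct_repr_tprod_apply]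
    congr 1
    rw [← Equiv.prod_comp σ]
    exact Finset.prod_congr rfl fun a _ => by rw [Function.comp_apply, Equiv.Perm.inv_def,
      Equiv.symm_apply_apply]
  | add x y hx hy => simp only [map_add, Finsupp.add_apply, hx, hy]

variable {ι k V : Type*} [Fintype ι] [DecidableEq ι] [Field k] [AddCommGroup V] [Module k V]

theorem toMatrix_piTensorProduct_map {r : ℕ} (b : Module.Basis ι k V) (φ : V →ₗ[k] V)
    (I J : Fin r → ι) :
    LinearMap.toMatrix (Basis.piTensorProduct fun _ : Fin r => b)
        (Basis.piTensorProduct fun _ : Fin r => b)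
        (PiTensorProduct.map fun _ : Fin r => φ) I J =
      ∏ a, LinearMap.toMatrix b b φ (I a) (J a) := by
  simp [LinearMap.toMatrix_apply]

/-- The matrix entries of an operator commuting with place permutations are constant on the orbits
of the diagonal action of the symmetric group on pairs of words. -/
theorem toMatrix_comp_perm {r : ℕ} (b : Module.Basis ι k V) {T : Module.End k (⨂[k]^r V)}
    (hT : T ∈ endSym k V r) (σ : Equiv.Perm (Fin r)) (I J : Fin r → ι) :
    LinearMap.toMatrix (Basis.piTensorProduct fun _ : Fin r => b)
        (Basis.piTensorProduct fun _ : Fin r => b) T (I ∘ σ) (J ∘ σ) =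
      LinearMap.toMatrix (Basis.piTensorProduct fun _ : Fin r => b)
        (Basis.piTensorProduct fun _ : Fin r => b) T I J := by
  rw [endSym, Subalgebra.mem_centralizer_iff] at hT
  have h := LinearMap.congr_fun (hT _ ⟨σ, rfl⟩)
    (PiTensorProduct.tprod k fun a => b ((J ∘ σ) a))
  simp only [Module.End.mul_apply, placePerm_tprod] at h
  rw [LinearMap.toMatrix_apply, LinearMap.toMatrix_apply, ← repr_placePerm,
    Basis.piTensorProduct_apply, Basis.piTensorProduct_apply, h]
  simp

theorem dual_apply_eq_sum_toMatrix {κ W : Type*} [Fintype κ] [DecidableEq κ] [AddCommGroup W]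
    [Module k W] (B : Module.Basis κ k W) (l : Module.End k W →ₗ[k] k) (S : Module.End k W) :
    l S = ∑ p : κ × κ,
      l (Matrix.toLin B B (single p.1 p.2 1)) * LinearMap.toMatrix B B S p.1 p.2 := by
  conv_lhs => rw [← Matrix.toLin_toMatrix B B S, matrix_eq_sum_single (LinearMap.toMatrix B B S)]
  simp only [map_sum]
  rw [← Fintype.sum_prod_type']
  refine Finset.sum_congr rfl fun p _ => ?_
  have hs : ∀ s : k, single p.1 p.2 s = s • single p.1 p.2 (1 : k) := by simp
  rw [hs, map_smul, map_smul, smul_eq_mul, mul_comm]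

/-- Over a field with more than `r` elements, every operator on `V^{⊗ r}` commuting with place
permutations is a linear combination of operators `g ⊗ ⋯ ⊗ g` with `g ∈ SL(V)`. -/
theorem mem_range_asAlgebraHom_repSL [FiniteDimensional k V] {r : ℕ}
    (hr : (r : ℕ∞) < ENat.card k) {T : Module.End k (⨂[k]^r V)} (hT : T ∈ endSym k V r) :
    T ∈ LinearMap.range (repSL k V r).asAlgebraHom.toLinearMap := by
  by_contra hmem
  obtain ⟨l, hlT, hl⟩ := Submodule.exists_le_ker_of_notMem hmem
  have b := Module.finBasis k V
  -- The product basis is kept opaque, so that unification does not unfold it.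
  obtain ⟨B, hB⟩ : ∃ B, B = Basis.piTensorProduct fun _ : Fin r => b := ⟨_, rfl⟩
  have hlc : ∀ S : Module.End k (⨂[k]^r V), l S =
      ∑ w : Fin r → Fin (Module.finrank k V) × Fin (Module.finrank k V),
        l (Matrix.toLin B B (single (fun a => (w a).1) (fun a => (w a).2) 1)) *
          LinearMap.toMatrix B B S (fun a => (w a).1) (fun a => (w a).2) := by
    intro S
    rw [dual_apply_eq_sum_toMatrix B l S]
    exact ((Equiv.arrowProdEquivProdArrow (Fin r) (fun _ => Fin (Module.finrank k V))
      (fun _ => Fin (Module.finrank k V))).sum_comp _).symm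
  refine hlT ?_
  rw [hlc]
  refine sum_mul_eq_zero_of_forall_specialLinearGroup hr _
    (fun w => LinearMap.toMatrix B B T (fun a => (w a).1) (fun a => (w a).2)) (fun g => ?_)
    fun w σ => ?_
  · have hg : repSL k V r (Matrix.SpecialLinearGroup.toLin_equiv b g) =
        PiTensorProduct.map fun _ : Fin r => Matrix.toLin b b (g : Matrix _ _ k) := rfl
    have h0 : l (repSL k V r (Matrix.SpecialLinearGroup.toLin_equiv b g)) = 0 :=
      hl ⟨MonoidAlgebra.single _ 1, Representation.asAlgebraHom_single_one _ _⟩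
    rw [hlc, hg] at h0
    refine Eq.trans ?_ h0
    refine Finset.sum_congr rfl fun w _ => ?_
    rw [hB, toMatrix_piTensorProduct_map, LinearMap.toMatrix_toLin]
  · rw [hB]
    exact toMatrix_comp_perm b hT σ (fun a => (w a).1) (fun a => (w a).2)

end TensorPower

end SchurWeyl

theorem mainTheorem3 {k V : Type*} [Field k] [AddCommGroup V] [Module k V]
    [FiniteDimensional k V] (r : ℕ) (hr : (r : ℕ∞) < ENat.card k) :
    Function.Surjective (SchurWeyl.phiGL k V r) ∧
      Function.Surjective (SchurWeyl.phiSL k V r) := by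
  have hSL : Function.Surjective (SchurWeyl.phiSL k V r) := fun T => by
    obtain ⟨a, ha⟩ := SchurWeyl.mem_range_asAlgebraHom_repSL hr T.2
    exact ⟨a, Subtype.ext ha⟩
  refine ⟨?_, hSL⟩
  -- `φ'` factors through `φ`, along the algebra map induced by `SL(V) → GL(V)`.
  have hfac : (SchurWeyl.phiGL k V r).comp (MonoidAlgebra.mapDomainAlgHom k k
      (SpecialLinearGroup.toGeneralLinearGroup (R := k) (V := V))) = SchurWeyl.phiSL k V r := by
    refine MonoidAlgebra.algHom_ext (fun g => Subtype.ext ?_) (Subsingleton.elim _ _)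
    simp [SchurWeyl.phiGL, SchurWeyl.phiSL, SchurWeyl.repSL]
  rw [← hfac] at hSL
  exact Function.Surjective.of_comp (f := SchurWeyl.phiGL k V r) hSL
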